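/- **Setting.** Let $p\ge 1$ and $k\ge 0$ be integers. For an integer $N\ge 2k+1$ put $\Gamma=\{1,\dots,N\}^p\subset\mathbb{Z}^p$, so that $|\Gamma|=N^p$, and for $i\in\Gamma$ let $\Lambda_i=\{j\in\mathbb{Z}^p: |j_a-i_a|\le k \text{ for all } a=1,\dots,p\}$ be the cube of side $2k+1$ centered at $i$. For a configuration $x=(x_j)_{j\in\Gamma}$ write $x_{\Lambda_i\cap\Gamma}=(x_j)_{j\in\Lambda_i\cap\Gamma}$. A function $f:\mathbb{R}^m\to\mathbb{R}$ is *pseudo-Lipschitz (of order 2) with constant* $L>0$ if $|f(x)-f(y)|\le L(1+\|x\|+\|y\|)\|x-y\|$ for all $x,y\in\mathbb{R}^m$, where $\|\cdot\|$ is the Euclidean norm. Let $E\subset\mathbb{R}$ with $|x|\le M$ for all $x\in E$, and let $X=(X_i)_{i\in\Gamma}$ be a random field with values in $E^\Gamma$ and law $\mu$. * $X$ is a *Markov random field of order $q$* if for all $i\in\Gamma$ and all measurable $B\subset E$, almost surely $P(X_i\in B\mid X_j,\,j\neq i)=P(X_i\in B\mid X_j,\,j\in\mathcal{N}_i^q)$,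 where $\mathcal{N}_i^q=\{j\in\Gamma\setminus\{i\}:\|i-j\|^2\le q\}$. * $X$ is *stationary* if for all $A\subset\Gamma$ and $i\in\Gamma$ with $i+A\subset\Gamma$ the families $(X_s)_{s\in A}$ and $(X_{i+s})_{s\in A}$ have the same law. * $\mu$ is a *Gibbs measure* for the single-site distributions $\mu_i(\cdot\mid\xi)$, $i\in\Gamma$, $\xi\in E^\Gamma$, if for every $i$ the map $\xi\mapsto\mu_i(\cdot\mid\xi)$ is a probability kernel that depends only on $(\xi_j)_{j\ne i}$ and is a regular version of the conditional law of $X_i$ given $(X_j)_{j\neq i}$. With $\|\rho_1-\rho_2\|_{\mathsf{tv}}=\sup_B|\rho_1(B)-\rho_2(B)|$ over measurable $B$, put $$C_{i,j}=\sup_{\substack{\xi,\xi'\in E^\Gamma\\ \xi_l=\xi'_l\ \forall l\neq j}}\|\mu_i(\cdot\mid\xi)-\mu_i(\cdot\mid\xi')\|_{\mathsf{tv}},\qquad i,j\in\Gamma .$$ The *Dobrushin uniqueness condition with constant* $c<1$ is $\sup_{i\in\Gamma}\sum_{j\in\Gamma}C_{i,j}\le c$; the *transposed* condition with constant $c^*<1$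 is $\sup_{j\in\Gamma}\sum_{i\in\Gamma}C_{i,j}\le c^*$. **Lemma.** For all $p,k,M,L$ and all $c,c^*<1$ there exist constants $K,\kappa>0$, depending only on $p,k,M,L,c,c^*$, such that the following holds. Let $N\ge 2k+1$ and $q\ge 0$ be integers, let $E\subset[-M,M]$, and let $X=(X_i)_{i\in\Gamma}$ be a stationary Markov random field of order $q$ with values in $E^\Gamma$ whose law $\mu$ is a Gibbs measure for single-site distributions satisfying the Dobrushin uniqueness condition with constant $c$ and the transposed condition with constant $c^*$. For every $i\in\Gamma$ let $f_i:\mathbb{R}^{\Lambda_i\cap\Gamma}\to\mathbb{R}$ be pseudo-Lipschitz with constant $L_i\le L$. Then for all $\epsilon\in(0,1)$, $$P\Big(\Big|\frac{1}{|\Gamma|}\sum_{i\in\Gamma}\big(f_i(X_{\Lambda_i\cap\Gamma})-\mathbb{E}[f_i(X_{\Lambda_i\cap\Gamma})]\big)\Big|\ge\epsilon\Big)\le K e^{-\kappa|\Gamma|\epsilon^2}.$$ -/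

import Mathlib

open MeasureTheory ProbabilityTheory

noncomputable section

namespace LatticeField

/-! ### Lattice, windows and pseudo-Lipschitz functions -/

/-- The lattice `Γ = [N]^p ⊆ ℤ^p`, where `[N] = {1, …, N}`. -/
def lattice (p N : ℕ) : Finset (Fin p → ℤ) :=
  Finset.Icc (fun _ => 1) (fun _ => (N : ℤ))

/-- The sliding window `Λ_i ⊆ ℤ^p`: the cube `Λ = [2k+1]^p` translated so that its center is `i`,
that is, `{j | i_a - k ≤ j_a ≤ i_a + k for every coordinate a}`. -/
def window {p : ℕ} (k : ℕ) (i : Fin p → ℤ) : Finset (Fin p → ℤ) :=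
  Finset.Icc (fun a => i a - (k : ℤ)) (fun a => i a + (k : ℤ))

/-- The part `Λ_i ∩ Γ` of the window that lies in the lattice. -/
def latticeWindow (p N k : ℕ) (i : Fin p → ℤ) : Finset (Fin p → ℤ) :=
  window k i ∩ lattice p N

/-- The window vector `x_{Λ_i ∩ Γ}` of a configuration `x` on `Γ` with values in `E ⊆ ℝ`, as an
element of Euclidean space. -/
def windowVec {p N : ℕ} (k : ℕ) {E : Set ℝ} (i : Fin p → ℤ) (x : lattice p N → E) :
    EuclideanSpace ℝ (latticeWindow p N k i) :=
  WithLp.toLp 2 fun j => (x ⟨j.1, (Finset.mem_inter.mp j.2).2⟩ : ℝ)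

/-- `f` is pseudo-Lipschitz of order 2 with constant `L > 0`. -/
def IsPseudoLipschitz {V : Type*} [Fintype V] (L : ℝ) (f : EuclideanSpace ℝ V → ℝ) : Prop :=
  0 < L ∧ ∀ x y, |f x - f y| ≤ L * (1 + ‖x‖ + ‖y‖) * ‖x - y‖

/-! ### Random fields -/

section Field

variable {S : Type*} [MeasurableSpace S]

/-- Restriction `ξ ↦ ξ_{i^c}` of a configuration to the sites other than `i`. -/
def offSite {V : Type*} (i : V) (ξ : V → S) : {j : V // j ≠ i} → S := fun j => ξ j.1

/-- A choice of single-site conditional distributions `μ_i(· | ξ)`, one for every site `i`. They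
are functions of `ξ_{i^c}`, defined at *every* boundary configuration. -/
abbrev SingleSiteKernels (V S : Type*) [MeasurableSpace S] :=
  (i : V) → Kernel ({j : V // j ≠ i} → S) S

/-- `μ` is a Gibbs measure for the single-site distributions `γ`: every `γ i` is a Markov kernel,
and it is a regular version of the conditional distribution under `μ` of the value at `i` given
the values at all other sites. -/
structure IsGibbs {V : Type*} (μ : Measure (V → S)) (γ : SingleSiteKernels V S) : Prop where
  isMarkovKernel : ∀ i, IsMarkovKernel (γ i)
  hasCondDistrib : ∀ i, HasCondDistrib (fun ξ => ξ i) (offSite i) (γ i) μ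

/-- The sites of `Γ` other than `i` whose squared Euclidean distance from `i` is at most `q`. -/
def neighborhood {p : ℕ} (Γ : Finset (Fin p → ℤ)) (q : ℕ) (i : Γ) : Set Γ :=
  {j | j ≠ i ∧ ∑ a, (i.1 a - j.1 a) ^ 2 ≤ (q : ℤ)}

/-- The σ-algebra on configurations generated by the coordinates in `A`. -/
abbrev coordSigma {V : Type*} (A : Set V) : MeasurableSpace (V → S) :=
  MeasurableSpace.comap (fun ξ (j : A) => ξ j.1) inferInstance

/-- The Markov property of order `q`: for every site `i` and measurable `B`, almost surely
`P(X_i ∈ B | X_j, j ≠ i) = P(X_i ∈ B | X_j, j ∈ N_i^q)`. -/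
def IsMarkovField {p : ℕ} {Γ : Finset (Fin p → ℤ)} (q : ℕ) (μ : Measure (Γ → S)) : Prop :=
  ∀ (i : Γ) (B : Set S), MeasurableSet B →
    μ⟦(fun ξ : Γ → S => ξ i) ⁻¹' B | coordSigma {j | j ≠ i}⟧
      =ᵐ[μ] μ⟦(fun ξ : Γ → S => ξ i) ⁻¹' B | coordSigma (neighborhood Γ q i)⟧

/-- Stationarity: for `A ⊆ Γ` and `i ∈ Γ` with `i + A ⊆ Γ`, the marginals of `μ` on `A` and on
`i + A` agree. -/
def IsStationary {p : ℕ} {Γ : Finset (Fin p → ℤ)} (μ : Measure (Γ → S)) : Prop :=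
  ∀ (A : Finset (Fin p → ℤ)) (hA : ∀ s ∈ A, s ∈ Γ) (i : Fin p → ℤ), i ∈ Γ →
    ∀ hiA : ∀ s ∈ A, i + s ∈ Γ,
      μ.map (fun ξ (s : A) => ξ ⟨s.1, hA s.1 s.2⟩) =
        μ.map (fun ξ (s : A) => ξ ⟨i + s.1, hiA s.1 s.2⟩)

/-! ### Dobrushin's conditions

All suprema below are suprema of bounded sets of nonnegative reals when the kernels are Markov. -/

/-- Total variation distance `sup_B |ρ₁(B) - ρ₂(B)|` over measurable sets `B`. -/
def tvDist (ρ₁ ρ₂ : Measure S) : ℝ :=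
  sSup {r | ∃ B, MeasurableSet B ∧ r = |ρ₁.real B - ρ₂.real B|}

variable {V : Type*}

/-- Dobrushin's interdependence matrix: `C i j` is the supremum of
`‖μ_i(· | ξ) - μ_i(· | ξ')‖_tv` over configurations `ξ, ξ'` that agree off the site `j`. -/
def dobrushinMatrix (γ : SingleSiteKernels V S) (i j : V) : ℝ :=
  sSup {r | ∃ ξ ξ' : V → S, (∀ l, l ≠ j → ξ l = ξ' l) ∧
    r = tvDist (γ i (offSite i ξ)) (γ i (offSite i ξ'))}

/-- The Dobrushin constant `sup_i ∑_j C i j`. -/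
def dobrushinConst [Fintype V] (γ : SingleSiteKernels V S) : ℝ :=
  ⨆ i, ∑ j, dobrushinMatrix γ i j

/-- The transposed Dobrushin constant `sup_j ∑_i C i j`. -/
def transposedDobrushinConst [Fintype V] (γ : SingleSiteKernels V S) : ℝ :=
  ⨆ j, ∑ i, dobrushinMatrix γ i j

end Field

end LatticeField

end

open LatticeField

open MeasureTheory ProbabilityTheory LatticeField

namespace LatticeField

/-! ### Functions of bounded oscillation on one site -/

section SingleSite

variable {S : Type*} [MeasurableSpace S]

/-! The average `g` of the window functions moves by at most `d = b / |Γ|` when one site changes,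
with `b` depending only on `p, k, M, L`. Concentration of such a `g` under a Gibbs measure comes
from the Glauber operator `T`, which resamples a uniformly chosen site. `T` preserves `μ`, and the
transposed Dobrushin condition makes it contract single-site oscillations by `r = 1 - (1 - c) / n`,
where `n = |Γ|` (`OscBounded.glauber`). Hence `g - E g` is the telescoping sum of the differences
`T^m g - T^(m+1) g`.

Tested against `exp (θ g)`, each difference is an average of single-site covariances, of size at
most `2 |θ| r^m d² E exp (θ g)` (`IsGibbs.integral_sub_glauber_mul_exp_le`). The geometric series
gives `m' θ ≤ v θ m θ` for the moment generating function of `g - E g`, with `v = 2 d² n / (1 - c)`.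
Integrating this inequality and applying Chernoff's bound gives a Gaussian tail; since `d = b / n`,
the exponent is of order `n ε²`. -/

lemma exp_mul_le_of_abs_le {x B : ℝ} (h : |x| ≤ B) (θ : ℝ) :
    Real.exp (θ * x) ≤ Real.exp (|θ| * B) := by
  rw [Real.exp_le_exp]
  refine (le_abs_self _).trans ?_
  rw [abs_mul]
  gcongr

lemma exists_abs_le_of_osc {S : Type*} {u : S → ℝ} {d : ℝ} (h : ∀ s t, |u s - u t| ≤ d) :
    ∃ B, ∀ s, |u s| ≤ B := by
  rcases isEmpty_or_nonempty S with hS | ⟨⟨s₀⟩⟩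
  · exact ⟨0, fun s => hS.elim s⟩
  · refine ⟨|u s₀| + d, fun s => ?_⟩
    linarith [h s s₀, abs_sub_abs_le_abs_sub (u s) (u s₀)]

lemma integrable_of_osc {u : S → ℝ} {d : ℝ} (hu : Measurable u) (h : ∀ s t, |u s - u t| ≤ d)
    (ρ : Measure S) [IsFiniteMeasure ρ] : Integrable u ρ := by
  obtain ⟨B, hB⟩ := exists_abs_le_of_osc h
  exact Integrable.of_bound hu.aestronglyMeasurable B (ae_of_all _ hB)

lemma integrable_exp_of_osc {u : S → ℝ} {d : ℝ} (hu : Measurable u) (h : ∀ s t, |u s - u t| ≤ d)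
    (ρ : Measure S) [IsFiniteMeasure ρ] (θ : ℝ) : Integrable (fun s => Real.exp (θ * u s)) ρ := by
  obtain ⟨B, hB⟩ := exists_abs_le_of_osc h
  refine Integrable.of_bound (by fun_prop) (Real.exp (|θ| * B)) (ae_of_all _ fun s => ?_)
  rw [Real.norm_eq_abs, Real.abs_exp]
  exact exp_mul_le_of_abs_le (hB s) θ

lemma integrable_mul_exp_of_osc {w u : S → ℝ} {a d : ℝ} (hw : Measurable w)
    (hwa : ∀ s t, |w s - w t| ≤ a) (hu : Measurable u) (h : ∀ s t, |u s - u t| ≤ d)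
    (ρ : Measure S) [IsFiniteMeasure ρ] (θ : ℝ) :
    Integrable (fun s => w s * Real.exp (θ * u s)) ρ := by
  obtain ⟨A, hA⟩ := exists_abs_le_of_osc hwa
  exact (integrable_exp_of_osc hu h ρ θ).bdd_mul hw.aestronglyMeasurable (ae_of_all _ hA)

lemma abs_sub_integral_le_of_osc {u : S → ℝ} {d : ℝ} (hu : Measurable u)
    (h : ∀ s t, |u s - u t| ≤ d) (ρ : Measure S) [IsProbabilityMeasure ρ] (s : S) :
    |u s - ∫ t, u t ∂ρ| ≤ d := by
  have hi := integrable_of_osc hu h ρ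
  have : u s - ∫ t, u t ∂ρ = ∫ t, (u s - u t) ∂ρ := by
    rw [integral_sub (integrable_const _) hi]; simp
  rw [this]
  simpa using norm_integral_le_of_norm_le_const (μ := ρ) (f := fun t => u s - u t)
    (ae_of_all _ fun t => h s t)

/-- Integrals of a function of oscillation `d` against two probability measures differ by at most
`d` times the total variation distance. -/
lemma abs_integral_sub_integral_le_of_osc {u : S → ℝ} {d τ : ℝ} (hu : Measurable u)
    (h : ∀ s t, |u s - u t| ≤ d) (ρ₁ ρ₂ : Measure S) [IsProbabilityMeasure ρ₁]
    [IsProbabilityMeasure ρ₂] (hτ : ∀ B, MeasurableSet B → |ρ₁.real B - ρ₂.real B| ≤ τ) :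
    |∫ s, u s ∂ρ₁ - ∫ s, u s ∂ρ₂| ≤ d * τ := by
  obtain ⟨s₀⟩ : Nonempty S := ρ₁.nonempty_of_neZero
  have hd : 0 ≤ d := (abs_nonneg _).trans (h s₀ s₀)
  have hbdd : BddBelow (Set.range u) := by
    refine ⟨u s₀ - d, ?_⟩
    rintro _ ⟨s, rfl⟩
    linarith [(abs_le.1 (h s₀ s)).2]
  have hne : (Set.range u).Nonempty := ⟨_, s₀, rfl⟩
  set m := sInf (Set.range u) with hm
  have hm0 : ∀ s, 0 ≤ u s - m := fun s => sub_nonneg.2 (csInf_le hbdd ⟨s, rfl⟩)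
  have hmd : ∀ s, u s - m ≤ d := by
    intro s
    have : u s - d ≤ m := by
      refine le_csInf hne ?_
      rintro _ ⟨t, rfl⟩
      linarith [(abs_le.1 (h s t)).2]
    linarith
  -- Layer cake formula: `u - m` takes values in `[0, d]`, and the tails under the two measures
  -- differ by at most `τ` at every level. Subtracting the infimum gives the factor `d`.
  have key : ∀ ρ : Measure S, IsProbabilityMeasure ρ →
      ∫ s, u s ∂ρ = m + ∫ t in Set.Ioc 0 d, ρ.real {s | t ≤ u s - m} := by
    intro ρ _
    have hi := integrable_of_osc hu h ρ
    have hl := (hi.sub (integrable_const m)).integral_eq_integral_Ioc_meas_le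
      (ae_of_all _ hm0) (ae_of_all _ hmd)
    simp only [Pi.sub_apply] at hl
    rw [← hl, integral_sub hi (integrable_const _)]
    simp
  have hint : ∀ ρ : Measure S, IsProbabilityMeasure ρ →
      IntegrableOn (fun t => ρ.real {s | t ≤ u s - m}) (Set.Ioc 0 d) := by
    intro ρ _
    have hanti : Antitone fun t => ρ.real {s | t ≤ u s - m} := fun a b hab =>
      measureReal_mono fun s (hs : b ≤ u s - m) => hab.trans hs
    exact (hanti.antitoneOn _).integrableOn_isCompact isCompact_Icc |>.mono_set
      Set.Ioc_subset_Icc_self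
  rw [key ρ₁ inferInstance, key ρ₂ inferInstance, add_sub_add_left_eq_sub,
    ← integral_sub (hint ρ₁ inferInstance) (hint ρ₂ inferInstance)]
  have := norm_setIntegral_le_of_norm_le_const (μ := volume) (s := Set.Ioc 0 d) (C := τ)
    (f := fun t => ρ₁.real {s | t ≤ u s - m} - ρ₂.real {s | t ≤ u s - m}) (by simp)
    (fun t _ => hτ _ (measurableSet_le measurable_const (hu.sub_const m)))
  simpa [Real.norm_eq_abs, hd, mul_comm] using this

/-- Follows from `1 + (y - x) ≤ exp (y - x)`. The larger exponential is relaxed to the sum, which is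
symmetric and can be integrated directly. -/
lemma abs_exp_sub_exp_le (x y : ℝ) :
    |Real.exp x - Real.exp y| ≤ |x - y| * (Real.exp x + Real.exp y) := by
  wlog h : y ≤ x generalizing x y
  · rw [abs_sub_comm, abs_sub_comm x, add_comm]
    exact this y x (le_of_not_ge h)
  rw [abs_of_nonneg (sub_nonneg.2 (Real.exp_le_exp.2 h)), abs_of_nonneg (sub_nonneg.2 h)]
  have h1 : Real.exp y = Real.exp x * Real.exp (y - x) := by rw [← Real.exp_add]; ring_nf
  have h2 := Real.add_one_le_exp (y - x)
  nlinarith [Real.exp_pos x, Real.exp_pos y, mul_le_mul_of_nonneg_left h2 (Real.exp_pos x).le,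
    mul_nonneg (sub_nonneg.2 h) (Real.exp_pos y).le]

lemma exp_mul_integral_le {u : S → ℝ} {d : ℝ} (hu : Measurable u)
    (h : ∀ s t, |u s - u t| ≤ d) (ρ : Measure S) [IsProbabilityMeasure ρ] (θ : ℝ) :
    Real.exp (θ * ∫ s, u s ∂ρ) ≤ ∫ s, Real.exp (θ * u s) ∂ρ := by
  have := convexOn_exp.map_integral_le (μ := ρ) (f := fun s => θ * u s)
    Real.continuous_exp.continuousOn isClosed_univ (by simp)
    ((integrable_of_osc hu h ρ).const_mul θ) (integrable_exp_of_osc hu h ρ θ)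
  rwa [integral_const_mul] at this

/-- The covariance of a function of oscillation `a` with the exponential of a function of
oscillation `d`. -/
lemma covariance_exp_le_of_osc {w u : S → ℝ} {a d : ℝ} (hw : Measurable w)
    (hwa : ∀ s t, |w s - w t| ≤ a) (hu : Measurable u) (hud : ∀ s t, |u s - u t| ≤ d)
    (ρ : Measure S) [IsProbabilityMeasure ρ] (θ : ℝ) :
    ∫ s, (w s - ∫ t, w t ∂ρ) * Real.exp (θ * u s) ∂ρ
      ≤ 2 * |θ| * a * d * ∫ s, Real.exp (θ * u s) ∂ρ := by
  obtain ⟨s₀⟩ : Nonempty S := ρ.nonempty_of_neZero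
  have ha : 0 ≤ a := (abs_nonneg _).trans (hwa s₀ s₀)
  have hd : 0 ≤ d := (abs_nonneg _).trans (hud s₀ s₀)
  set w' := fun s => w s - ∫ t, w t ∂ρ with hw'
  have hwi := integrable_of_osc hw hwa ρ
  have hw'0 : ∫ s, w' s ∂ρ = 0 := by
    rw [hw', integral_sub hwi (integrable_const _)]; simp
  have hw'm : Measurable w' := hw.sub_const _
  have hw'a : ∀ s t, |w' s - w' t| ≤ a := fun s t => by simpa [hw'] using hwa s t
  set K := Real.exp (θ * ∫ s, u s ∂ρ) with hK
  have hei := integrable_exp_of_osc hu hud ρ θ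
  -- Since `w'` is centred, any constant may be subtracted from the exponential. This `K` is close
  -- to it pointwise, and Jensen bounds it by the integral of the exponential.
  have h1 : ∫ s, w' s * Real.exp (θ * u s) ∂ρ = ∫ s, w' s * (Real.exp (θ * u s) - K) ∂ρ := by
    simp_rw [mul_sub]
    rw [integral_sub (integrable_mul_exp_of_osc hw'm hw'a hu hud ρ θ)
      ((integrable_of_osc hw'm hw'a ρ).mul_const K), integral_mul_const, hw'0]
    simp
  have h2 : ∀ s, w' s * (Real.exp (θ * u s) - K) ≤ |θ| * a * d * (Real.exp (θ * u s) + K) := by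
    intro s
    have e1 : |w' s| ≤ a := abs_sub_integral_le_of_osc hw hwa ρ s
    have e2 : |Real.exp (θ * u s) - K| ≤ |θ| * d * (Real.exp (θ * u s) + K) := by
      refine (abs_exp_sub_exp_le _ _).trans ?_
      rw [← mul_sub, abs_mul]
      gcongr
      exact abs_sub_integral_le_of_osc hu hud ρ s
    calc _ ≤ |w' s * (Real.exp (θ * u s) - K)| := le_abs_self _
      _ = |w' s| * |Real.exp (θ * u s) - K| := abs_mul _ _
      _ ≤ a * (|θ| * d * (Real.exp (θ * u s) + K)) := by gcongr
      _ = _ := by ring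
  rw [h1]
  calc _ ≤ ∫ s, |θ| * a * d * (Real.exp (θ * u s) + K) ∂ρ := by
        refine integral_mono ?_ ((hei.add (integrable_const K)).const_mul _) h2
        simp_rw [mul_sub]
        exact (integrable_mul_exp_of_osc hw'm hw'a hu hud ρ θ).sub
          ((integrable_of_osc hw'm hw'a ρ).mul_const K)
    _ = |θ| * a * d * (∫ s, Real.exp (θ * u s) ∂ρ + K) := by
        rw [integral_const_mul, integral_add hei (integrable_const K)]; simp
    _ ≤ |θ| * a * d * (∫ s, Real.exp (θ * u s) ∂ρ + ∫ s, Real.exp (θ * u s) ∂ρ) := by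
        gcongr
        exact exp_mul_integral_le hu hud ρ θ
    _ = _ := by ring

end SingleSite

/-! ### Glauber dynamics -/

noncomputable section Glauber

lemma offSite_update {V S : Type*} [DecidableEq V] (i : V) (ξ : V → S) (s : S) :
    offSite i (Function.update ξ i s) = offSite i ξ := by
  funext j
  simp [offSite, j.2]

variable {V S : Type*} [MeasurableSpace S]

/-- `g` is measurable and changes by at most `d` when a single coordinate is changed. -/
structure OscBounded (g : (V → S) → ℝ) (d : ℝ) : Prop where
  measurable : Measurable g
  osc : ∀ j ξ ξ', (∀ l, l ≠ j → ξ l = ξ' l) → |g ξ - g ξ'| ≤ d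

variable {g w : (V → S) → ℝ} {a d c : ℝ} {μ : Measure (V → S)} {γ : SingleSiteKernels V S}

lemma OscBounded.sub_const (hg : OscBounded g d) (m : ℝ) : OscBounded (fun ξ => g ξ - m) d :=
  ⟨hg.measurable.sub_const m, fun j ξ ξ' h => by simpa using hg.osc j ξ ξ' h⟩

lemma OscBounded.neg (hg : OscBounded g d) : OscBounded (fun ξ => - g ξ) d :=
  ⟨hg.measurable.neg, fun j ξ ξ' h => by
    rw [neg_sub_neg, abs_sub_comm]; exact hg.osc j ξ ξ' h⟩

/-- Coordinates are changed one at a time. The resulting boundedness supplies every integrability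
claim below. -/
lemma OscBounded.abs_sub_le_card_mul [Fintype V] (hg : OscBounded g d) (ξ ξ' : V → S) :
    |g ξ - g ξ'| ≤ Fintype.card V * d := by
  classical
  suffices H : ∀ (A : Finset V) (ξ : V → S), (∀ l, l ∉ A → ξ l = ξ' l) →
      |g ξ - g ξ'| ≤ A.card * d from H Finset.univ ξ (by simp)
  intro A
  induction A using Finset.induction_on with
  | empty =>
    intro ξ h
    obtain rfl : ξ = ξ' := funext fun l => h l (by simp)
    simp
  | insert i A hi ih =>
    intro ξ h
    have h1 : |g ξ - g (Function.update ξ i (ξ' i))| ≤ d :=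
      hg.osc i _ _ fun l hl => by simp [hl]
    have h2 : |g (Function.update ξ i (ξ' i)) - g ξ'| ≤ A.card * d := by
      refine ih _ fun l hl => ?_
      by_cases hli : l = i
      · subst hli; simp
      · simpa [hli] using h l (by simp [hli, hl])
    rw [Finset.card_insert_of_notMem hi]
    push_cast
    linarith [abs_sub_le (g ξ) (g (Function.update ξ i (ξ' i))) (g ξ')]

lemma measurable_offSite (i : V) : Measurable (offSite i : (V → S) → _) :=
  measurable_pi_lambda _ fun j => measurable_pi_apply j.1

lemma abs_real_sub_le_dobrushinMatrix (hγ : ∀ i, IsMarkovKernel (γ i)) (i j : V)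
    {ξ ξ' : V → S} (h : ∀ l, l ≠ j → ξ l = ξ' l) {B : Set S} (hB : MeasurableSet B) :
    |(γ i (offSite i ξ)).real B - (γ i (offSite i ξ')).real B| ≤ dobrushinMatrix γ i j := by
  have := hγ i
  have hle : ∀ (ρ₁ ρ₂ : Measure S) [IsProbabilityMeasure ρ₁] [IsProbabilityMeasure ρ₂]
      (B : Set S), |ρ₁.real B - ρ₂.real B| ≤ 1 := by
    intro ρ₁ ρ₂ _ _ B
    rw [abs_le]
    constructor <;> linarith [measureReal_nonneg (μ := ρ₁) (s := B),
      measureReal_nonneg (μ := ρ₂) (s := B), measureReal_le_one (μ := ρ₁) (s := B),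
      measureReal_le_one (μ := ρ₂) (s := B)]
  calc _ ≤ tvDist (γ i (offSite i ξ)) (γ i (offSite i ξ')) := by
        refine le_csSup ⟨1, ?_⟩ ⟨B, hB, rfl⟩
        rintro _ ⟨B, -, rfl⟩
        exact hle _ _ B
    _ ≤ _ := by
        refine le_csSup ⟨1, ?_⟩ ⟨ξ, ξ', h, rfl⟩
        rintro _ ⟨η, η', -, rfl⟩
        refine Real.sSup_le ?_ zero_le_one
        rintro _ ⟨B, -, rfl⟩
        exact hle _ _ B

lemma dobrushinMatrix_nonneg (i j : V) : 0 ≤ dobrushinMatrix γ i j := by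
  refine Real.sSup_nonneg ?_
  rintro _ ⟨ξ, ξ', -, rfl⟩
  refine Real.sSup_nonneg ?_
  rintro _ ⟨B, -, rfl⟩
  exact abs_nonneg _

lemma sum_dobrushinMatrix_le [Fintype V] (hc : transposedDobrushinConst γ ≤ c) (j : V) :
    ∑ i, dobrushinMatrix γ i j ≤ c :=
  (le_ciSup (f := fun j => ∑ i, dobrushinMatrix γ i j) (Set.finite_range _).bddAbove j).trans hc

lemma OscBounded.integrable [Fintype V] [IsFiniteMeasure μ] (hg : OscBounded g d) : Integrable g μ :=
  integrable_of_osc hg.measurable hg.abs_sub_le_card_mul μ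

variable [DecidableEq V]

lemma OscBounded.measurable_update (hg : OscBounded g d) (i : V) (ξ : V → S) :
    Measurable fun s => g (Function.update ξ i s) :=
  hg.measurable.comp (_root_.measurable_update ξ)

lemma OscBounded.osc_update (hg : OscBounded g d) (i : V) (ξ : V → S) (s t : S) :
    |g (Function.update ξ i s) - g (Function.update ξ i t)| ≤ d :=
  hg.osc i _ _ fun l hl => by simp [hl]

/-- The expectation of `g` after the value at the site `i` is resampled. -/
def resample (γ : SingleSiteKernels V S) (i : V) (g : (V → S) → ℝ) (ξ : V → S) : ℝ :=
  ∫ s, g (Function.update ξ i s) ∂γ i (offSite i ξ)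

/-- One step of the Glauber dynamics: resample at a uniformly chosen site. -/
def glauber [Fintype V] (γ : SingleSiteKernels V S) (g : (V → S) → ℝ) (ξ : V → S) : ℝ :=
  (Fintype.card V : ℝ)⁻¹ * ∑ i, resample γ i g ξ

lemma measurable_resample (hγ : ∀ i, IsMarkovKernel (γ i)) (hg : Measurable g) (i : V) :
    Measurable (resample γ i g) := by
  have := hγ i
  have h := (hg.comp (measurable_update' (a := i) (X := fun _ => S))).stronglyMeasurable
  exact (h.integral_kernel_prod_right' (κ := (γ i).comap _ (measurable_offSite i))).measurable

lemma measurable_glauber [Fintype V] (hγ : ∀ i, IsMarkovKernel (γ i)) (hg : Measurable g) :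
    Measurable (glauber γ g) :=
  (Finset.measurable_sum _ fun i _ => measurable_resample hγ hg i).const_mul _

lemma abs_resample_le (hγ : ∀ i, IsMarkovKernel (γ i)) {B : ℝ} (hB : ∀ ξ, |g ξ| ≤ B) (i : V)
    (ξ : V → S) : |resample γ i g ξ| ≤ B := by
  have := hγ i
  simpa [resample] using norm_integral_le_of_norm_le_const (μ := γ i (offSite i ξ))
    (f := fun s => g (Function.update ξ i s)) (ae_of_all _ fun s => hB _)

lemma integrable_resample [IsFiniteMeasure μ] (hγ : ∀ i, IsMarkovKernel (γ i))
    (hg : Measurable g) {B : ℝ} (hB : ∀ ξ, |g ξ| ≤ B) (i : V) :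
    Integrable (resample γ i g) μ :=
  Integrable.of_bound (measurable_resample hγ hg i).aestronglyMeasurable B
    (ae_of_all _ (abs_resample_le hγ hB i))

/-- A Gibbs measure is invariant under resampling at a site. -/
lemma IsGibbs.integral_resample [IsProbabilityMeasure μ] (hμ : IsGibbs μ γ) (i : V)
    (hg : Measurable g) (hgi : Integrable g μ) : ∫ ξ, resample γ i g ξ ∂μ = ∫ ξ, g ξ ∂μ := by
  have := hμ.isMarkovKernel i
  -- `glue` rebuilds a configuration from its off-site part and its value at `i`, so that the
  -- disintegration of `μ` can be applied to `g`.
  let glue : ({j : V // j ≠ i} → S) × S → V → S := fun z j =>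
    if h : j = i then z.2 else z.1 ⟨j, h⟩
  have hglue : Measurable glue := by
    refine measurable_pi_lambda _ fun j => ?_
    by_cases h : j = i
    · simpa [glue, h] using measurable_snd
    · simp only [glue, h, dite_false]
      exact (measurable_pi_apply _).comp measurable_fst
  have hu : ∀ ξ s, glue (offSite i ξ, s) = Function.update ξ i s := by
    intro ξ s
    funext j
    by_cases h : j = i
    · subst h; simp [glue]
    · simp [glue, h, offSite]
  have hmap : μ.map (fun ξ => (offSite i ξ, ξ i)) = μ.map (offSite i) ⊗ₘ γ i :=
    (hμ.hasCondDistrib i).map_eq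
  have hgm : Measurable fun z => g (glue z) := hg.comp hglue
  have hpair : Measurable fun ξ : V → S => (offSite i ξ, ξ i) :=
    (measurable_offSite i).prodMk (measurable_pi_apply i)
  have hgg : ∀ ξ, g (glue (offSite i ξ, ξ i)) = g ξ := fun ξ => by rw [hu]; simp
  have hint : Integrable (fun z => g (glue z)) (μ.map (offSite i) ⊗ₘ γ i) := by
    rw [← hmap, integrable_map_measure hgm.aestronglyMeasurable hpair.aemeasurable]
    exact hgi.congr (ae_of_all _ fun ξ => (hgg ξ).symm)
  have hprob : IsProbabilityMeasure (μ.map (offSite i)) :=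
    Measure.isProbabilityMeasure_map (measurable_offSite i).aemeasurable
  calc ∫ ξ, resample γ i g ξ ∂μ
      = ∫ ξ, (fun η => ∫ s, g (glue (η, s)) ∂γ i η) (offSite i ξ) ∂μ := by
        simp only [resample, hu]
    _ = ∫ η, ∫ s, g (glue (η, s)) ∂γ i η ∂μ.map (offSite i) := by
        have hm := hgm.stronglyMeasurable.integral_kernel_prod_right' (κ := γ i)
        exact (integral_map (measurable_offSite i).aemeasurable hm.aestronglyMeasurable).symm
    _ = ∫ z, g (glue z) ∂(μ.map (offSite i) ⊗ₘ γ i) := (Measure.integral_compProd hint).symm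
    _ = ∫ ξ, g ξ ∂μ := by
        rw [← hmap, integral_map hpair.aemeasurable hgm.aestronglyMeasurable]
        simp only [hgg]

/-- Changing site `j` alters the integrand, except when `i = j` because the value there is
overwritten, and it alters the kernel, which costs `d` times a total variation distance. -/
lemma OscBounded.resample_sub_le (hγ : ∀ i, IsMarkovKernel (γ i)) (hg : OscBounded g d)
    (i j : V) {ξ ξ' : V → S} (h : ∀ l, l ≠ j → ξ l = ξ' l) :
    |resample γ i g ξ - resample γ i g ξ'|
      ≤ (if i = j then 0 else d) + d * dobrushinMatrix γ i j := by
  have := hγ i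
  have hi := fun η ρ [IsProbabilityMeasure ρ] =>
    integrable_of_osc (hg.measurable_update i η) (hg.osc_update i η) ρ
  have h1 : |∫ s, (g (Function.update ξ i s) - g (Function.update ξ' i s)) ∂γ i (offSite i ξ)|
      ≤ if i = j then 0 else d := by
    have hb : ∀ s, ‖g (Function.update ξ i s) - g (Function.update ξ' i s)‖
        ≤ if i = j then 0 else d := by
      intro s
      split_ifs with hij
      · have : Function.update ξ i s = Function.update ξ' i s := by
          funext l
          by_cases hl : l = i
          · subst hl; simp
          · simpa [hl] using h l (hij ▸ hl)
        simp [this]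
      · refine hg.osc j _ _ fun l hl => ?_
        by_cases hli : l = i
        · subst hli; simp
        · simpa [hli] using h l hl
    simpa using norm_integral_le_of_norm_le_const (μ := γ i (offSite i ξ)) (ae_of_all _ hb)
  have h2 := abs_integral_sub_integral_le_of_osc (hg.measurable_update i ξ') (hg.osc_update i ξ')
    (γ i (offSite i ξ)) (γ i (offSite i ξ'))
    fun B hB => abs_real_sub_le_dobrushinMatrix hγ i j h hB
  rw [integral_sub (hi _ _) (hi _ _)] at h1
  exact (abs_sub_le _ _ _).trans (add_le_add h1 h2)

lemma OscBounded.abs_sub_resample_le (hγ : ∀ i, IsMarkovKernel (γ i)) (hg : OscBounded g d)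
    (i : V) (ξ : V → S) : |g ξ - resample γ i g ξ| ≤ d := by
  have := hγ i
  simpa [resample] using abs_sub_integral_le_of_osc (hg.measurable_update i ξ) (hg.osc_update i ξ)
    (γ i (offSite i ξ)) (ξ i)

variable [Fintype V]

/-- Under the transposed Dobrushin condition the Glauber dynamics contracts oscillations. -/
lemma OscBounded.glauber [Nonempty V] (hγ : ∀ i, IsMarkovKernel (γ i))
    (hc : transposedDobrushinConst γ ≤ c) (hd : 0 ≤ d) (hg : OscBounded g d) :
    OscBounded (glauber γ g) ((1 - (1 - c) / Fintype.card V) * d) := by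
  refine ⟨measurable_glauber hγ hg.measurable, fun j ξ ξ' h => ?_⟩
  have hn : (0 : ℝ) < Fintype.card V := by exact_mod_cast Fintype.card_pos
  rw [LatticeField.glauber, LatticeField.glauber, ← mul_sub, ← Finset.sum_sub_distrib, abs_mul,
    abs_of_pos (inv_pos.2 hn)]
  -- The `n - 1` sites other than `j` contribute `d` each; column `j` of the Dobrushin matrix adds
  -- at most `c * d`.
  have h1 : |∑ i, (resample γ i g ξ - resample γ i g ξ')| ≤ (Fintype.card V - 1 + c) * d := by
    calc _ ≤ ∑ i, |resample γ i g ξ - resample γ i g ξ'| := Finset.abs_sum_le_sum_abs _ _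
      _ ≤ ∑ i, ((if i = j then 0 else d) + d * dobrushinMatrix γ i j) :=
        Finset.sum_le_sum fun i _ => hg.resample_sub_le hγ i j h
      _ = (Fintype.card V - 1) * d + d * ∑ i, dobrushinMatrix γ i j := by
        rw [Finset.sum_add_distrib, Finset.mul_sum]
        congr 1
        have : ∀ i, (if i = j then 0 else d) = d - if i = j then d else 0 := by
          intro i; split_ifs <;> simp
        simp_rw [this]
        rw [Finset.sum_sub_distrib]
        simp
        ring
      _ ≤ (Fintype.card V - 1) * d + d * c := by
        gcongr
        exact sum_dobrushinMatrix_le hc j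
      _ = _ := by ring
  calc _ ≤ (Fintype.card V : ℝ)⁻¹ * ((Fintype.card V - 1 + c) * d) := by gcongr
    _ = _ := by field_simp; ring

lemma IsGibbs.integral_glauber [Nonempty V] [IsProbabilityMeasure μ] (hμ : IsGibbs μ γ)
    (hg : OscBounded g d) :
    ∫ ξ, glauber γ g ξ ∂μ = ∫ ξ, g ξ ∂μ := by
  have hn : (Fintype.card V : ℝ) ≠ 0 := by exact_mod_cast Fintype.card_ne_zero
  obtain ⟨B, hB⟩ := exists_abs_le_of_osc hg.abs_sub_le_card_mul
  have hi := integrable_resample (μ := μ) hμ.isMarkovKernel hg.measurable hB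
  simp only [glauber]
  rw [integral_const_mul, integral_finsetSum _ fun i _ => hi i]
  simp only [hμ.integral_resample _ hg.measurable hg.integrable]
  simp [hn]

/-- Given the values off `i`, the factor `w - resample γ i w` is centred, so the left side is the
mean of a single-site covariance, bounded by `covariance_exp_le_of_osc`. -/
lemma IsGibbs.integral_sub_resample_mul_exp_le [IsProbabilityMeasure μ] (hμ : IsGibbs μ γ)
    (hw : OscBounded w a) (hg : OscBounded g d) (i : V) (θ : ℝ) :
    ∫ ξ, (w ξ - resample γ i w ξ) * Real.exp (θ * g ξ) ∂μ
      ≤ 2 * |θ| * a * d * ∫ ξ, Real.exp (θ * g ξ) ∂μ := by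
  have hγ := hμ.isMarkovKernel
  have := hγ i
  have hwm := hw.measurable
  have hgm := hg.measurable
  have hrm := measurable_resample hγ hwm i
  have hei : Integrable (fun ξ => Real.exp (θ * g ξ)) μ :=
    integrable_exp_of_osc hgm hg.abs_sub_le_card_mul μ θ
  have hm : Measurable fun ξ => (w ξ - resample γ i w ξ) * Real.exp (θ * g ξ) := by fun_prop
  have hint : Integrable (fun ξ => (w ξ - resample γ i w ξ) * Real.exp (θ * g ξ)) μ :=
    hei.bdd_mul (c := a) (by fun_prop) (ae_of_all _ fun ξ => hw.abs_sub_resample_le hγ i ξ)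
  have hrr : ∀ ξ s, resample γ i w (Function.update ξ i s) = resample γ i w ξ := by
    intro ξ s
    simp only [resample, offSite_update, Function.update_idem]
  have hpt : ∀ ξ, resample γ i (fun ξ => (w ξ - resample γ i w ξ) * Real.exp (θ * g ξ)) ξ
      ≤ 2 * |θ| * a * d * resample γ i (fun ξ => Real.exp (θ * g ξ)) ξ := by
    intro ξ
    have := covariance_exp_le_of_osc (hw.measurable_update i ξ) (hw.osc_update i ξ)
      (hg.measurable_update i ξ) (hg.osc_update i ξ) (γ i (offSite i ξ)) θ
    rw [resample]
    simp only [hrr]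
    exact this
  rw [← hμ.integral_resample i hm hint, ← hμ.integral_resample i (by fun_prop) hei,
    ← integral_const_mul]
  obtain ⟨B, hB⟩ := exists_abs_le_of_osc hg.abs_sub_le_card_mul
  have hexp : ∀ ξ, |Real.exp (θ * g ξ)| ≤ Real.exp (|θ| * B) := fun ξ => by
    rw [Real.abs_exp]
    exact exp_mul_le_of_abs_le (hB ξ) θ
  refine integral_mono (integrable_resample hγ hm (B := a * Real.exp (|θ| * B)) (fun ξ => ?_) i)
    ((integrable_resample hγ (by fun_prop) hexp i).const_mul _) hpt
  rw [abs_mul]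
  exact mul_le_mul (hw.abs_sub_resample_le hγ i ξ) (hexp ξ) (abs_nonneg _)
    ((abs_nonneg _).trans (hw.abs_sub_resample_le hγ i ξ))

lemma IsGibbs.integral_sub_glauber_mul_exp_le [Nonempty V] [IsProbabilityMeasure μ]
    (hμ : IsGibbs μ γ) (hw : OscBounded w a) (hg : OscBounded g d) (θ : ℝ) :
    ∫ ξ, (w ξ - glauber γ w ξ) * Real.exp (θ * g ξ) ∂μ
      ≤ 2 * |θ| * a * d * ∫ ξ, Real.exp (θ * g ξ) ∂μ := by
  have hn : (0 : ℝ) < Fintype.card V := by exact_mod_cast Fintype.card_pos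
  have hγ := hμ.isMarkovKernel
  have hgm := hg.measurable
  have h1 : ∀ ξ, (w ξ - glauber γ w ξ) * Real.exp (θ * g ξ) = (Fintype.card V : ℝ)⁻¹ *
      ∑ i, (w ξ - resample γ i w ξ) * Real.exp (θ * g ξ) := by
    intro ξ
    rw [← Finset.sum_mul, Finset.sum_sub_distrib, ← mul_assoc, mul_sub, glauber]
    simp [hn.ne']
  have hint : ∀ i, Integrable (fun ξ => (w ξ - resample γ i w ξ) * Real.exp (θ * g ξ)) μ :=
    fun i => (integrable_exp_of_osc hgm hg.abs_sub_le_card_mul μ θ).bdd_mul (c := a)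
      (hw.measurable.sub (measurable_resample hγ hw.measurable i)).aestronglyMeasurable
      (ae_of_all _ fun ξ => hw.abs_sub_resample_le hγ i ξ)
  simp only [h1]
  rw [integral_const_mul, integral_finsetSum _ fun i _ => hint i]
  calc _ ≤ (Fintype.card V : ℝ)⁻¹ *
        ∑ _i : V, 2 * |θ| * a * d * ∫ ξ, Real.exp (θ * g ξ) ∂μ := by
        gcongr with i
        exact hμ.integral_sub_resample_mul_exp_le hw hg i θ
    _ = _ := by simp [hn.ne']

end Glauber

/-! ### Gaussian concentration from the contraction of the Glauber dynamics. -/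

section Concentration

variable {V S : Type*} [MeasurableSpace S] [Fintype V] [Nonempty V] {g : (V → S) → ℝ} {d c : ℝ}
  {μ : Measure (V → S)} {γ : SingleSiteKernels V S}

lemma OscBounded.iterate_glauber [DecidableEq V] (hγ : ∀ i, IsMarkovKernel (γ i))
    (hc : transposedDobrushinConst γ ≤ c)
    (hr : 0 ≤ 1 - (1 - c) / Fintype.card V) (hd : 0 ≤ d) (hg : OscBounded g d) (m : ℕ) :
    OscBounded ((LatticeField.glauber γ)^[m] g) ((1 - (1 - c) / Fintype.card V) ^ m * d) := by
  induction m with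
  | zero => simpa using hg
  | succ m ih =>
    rw [Function.iterate_succ_apply', pow_succ', mul_assoc]
    exact ih.glauber hγ hc (by positivity)

/-- The differential inequality behind the concentration estimate, obtained by summing the Glauber
dynamics over time. -/
lemma IsGibbs.integral_sub_integral_mul_exp_le [IsProbabilityMeasure μ] (hμ : IsGibbs μ γ)
    (hc : transposedDobrushinConst γ ≤ c) (hc1 : c < 1) (hg : OscBounded g d) (hd : 0 ≤ d)
    (θ : ℝ) :
    ∫ ξ, (g ξ - ∫ η, g η ∂μ) * Real.exp (θ * g ξ) ∂μ
      ≤ 2 * |θ| * d ^ 2 * (Fintype.card V / (1 - c)) * ∫ ξ, Real.exp (θ * g ξ) ∂μ := by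
  classical
  set n : ℝ := (Fintype.card V : ℝ) with hn
  have hn1 : 1 ≤ n := Nat.one_le_cast.2 Fintype.card_pos
  -- Together with `1 ≤ n`, this is what makes the contraction factor `r` nonnegative.
  have hc0 : 0 ≤ c := (Finset.sum_nonneg fun i _ => dobrushinMatrix_nonneg i _).trans
    (sum_dobrushinMatrix_le hc (Classical.arbitrary V))
  have hγ := hμ.isMarkovKernel
  set r : ℝ := 1 - (1 - c) / n with hr
  have hr0 : 0 ≤ r := by
    rw [hr, sub_nonneg, div_le_one (by linarith)]
    linarith
  have hr1 : r < 1 := by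
    have : 0 < (1 - c) / n := by apply div_pos <;> linarith
    linarith
  set u : ℕ → (V → S) → ℝ := fun m => (glauber γ)^[m] g with hu
  have hu0 : u 0 = g := rfl
  have hus : ∀ m, u (m + 1) = glauber γ (u m) := fun m => Function.iterate_succ_apply' _ _ _
  have huo : ∀ m, OscBounded (u m) (r ^ m * d) := hg.iterate_glauber hγ hc hr0 hd
  have hum : ∀ m, ∫ ξ, u m ξ ∂μ = ∫ ξ, g ξ ∂μ := by
    intro m
    induction m with
    | zero => rfl
    | succ m ih => rw [hus, hμ.integral_glauber (huo m), ih]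
  set Z := ∫ ξ, Real.exp (θ * g ξ) ∂μ with hZ
  have hZ0 : 0 ≤ Z := integral_nonneg fun ξ => (Real.exp_pos _).le
  have hei : Integrable (fun ξ => Real.exp (θ * g ξ)) μ :=
    integrable_exp_of_osc hg.measurable hg.abs_sub_le_card_mul μ θ
  have hui : ∀ m, Integrable (fun ξ => u m ξ * Real.exp (θ * g ξ)) μ := fun m =>
    integrable_mul_exp_of_osc (huo m).measurable (huo m).abs_sub_le_card_mul hg.measurable
      hg.abs_sub_le_card_mul μ θ
  have hstep : ∀ m, ∫ ξ, u m ξ * Real.exp (θ * g ξ) ∂μ - ∫ ξ, u (m + 1) ξ * Real.exp (θ * g ξ) ∂μ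
      ≤ 2 * |θ| * d ^ 2 * Z * r ^ m := by
    intro m
    have := hμ.integral_sub_glauber_mul_exp_le (huo m) hg θ
    rw [← integral_sub (hui m) (hui (m + 1))]
    simp only [← sub_mul, hus]
    refine this.trans (le_of_eq ?_)
    ring
  -- The steps telescope, and the geometric series sums to `1 / (1 - r) = n / (1 - c)`.
  have htel : ∀ m, ∫ ξ, g ξ * Real.exp (θ * g ξ) ∂μ - ∫ ξ, u m ξ * Real.exp (θ * g ξ) ∂μ
      ≤ 2 * |θ| * d ^ 2 * (n / (1 - c)) * Z := by
    intro m
    have hsum := Finset.sum_range_sub' (fun m => ∫ ξ, u m ξ * Real.exp (θ * g ξ) ∂μ) m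
    simp only [hu0] at hsum
    rw [← hsum]
    calc _ ≤ ∑ k ∈ Finset.range m, 2 * |θ| * d ^ 2 * Z * r ^ k :=
          Finset.sum_le_sum fun k _ => hstep k
      _ = 2 * |θ| * d ^ 2 * Z * ∑ k ∈ Finset.range m, r ^ k := by rw [Finset.mul_sum]
      _ ≤ 2 * |θ| * d ^ 2 * Z * (1 - r)⁻¹ := by
          gcongr
          rw [← tsum_geometric_of_lt_one hr0 hr1]
          exact (summable_geometric_of_lt_one hr0 hr1).sum_le_tsum _ fun k _ => by positivity
      _ = _ := by
          rw [hr, sub_sub_cancel, inv_div]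
          ring
  -- `u m` has the same mean as `g` and total oscillation at most `n * (r ^ m * d)`, so the
  -- remainder vanishes as `m` grows.
  have hlim : ∀ m, ∫ ξ, u m ξ * Real.exp (θ * g ξ) ∂μ - (∫ η, g η ∂μ) * Z
      ≤ n * (r ^ m * d) * Z := by
    intro m
    rw [hZ, ← integral_const_mul, ← integral_const_mul,
      ← integral_sub (hui m) (hei.const_mul _)]
    refine integral_mono ((hui m).sub (hei.const_mul _)) (hei.const_mul _) fun ξ => ?_
    simp only [← sub_mul]
    gcongr
    rw [← hum m]
    exact (le_abs_self _).trans
      (abs_sub_integral_le_of_osc (huo m).measurable (huo m).abs_sub_le_card_mul μ ξ)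
  have hsplit : ∫ ξ, (g ξ - ∫ η, g η ∂μ) * Real.exp (θ * g ξ) ∂μ
      = ∫ ξ, g ξ * Real.exp (θ * g ξ) ∂μ - (∫ η, g η ∂μ) * Z := by
    simp only [sub_mul]
    rw [integral_sub (hu0 ▸ hui 0) (hei.const_mul _), integral_const_mul]
  have htend : Filter.Tendsto
      (fun m : ℕ => 2 * |θ| * d ^ 2 * (n / (1 - c)) * Z + n * (r ^ m * d) * Z) Filter.atTop
      (nhds (2 * |θ| * d ^ 2 * (n / (1 - c)) * Z + n * (0 * d) * Z)) :=
    ((((tendsto_pow_atTop_nhds_zero_of_lt_one hr0 hr1).mul_const d).const_mul n).mul_const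
      Z).const_add _
  have := ge_of_tendsto' htend (b := ∫ ξ, (g ξ - ∫ η, g η ∂μ) * Real.exp (θ * g ξ) ∂μ)
    fun m => by rw [hsplit]; linarith [htel m, hlim m]
  simpa using this

/-- A random variable whose moment generating function satisfies `m' θ ≤ v θ m θ` for `θ ≥ 0` has
a Gaussian upper tail with variance proxy `v`. -/
lemma measureReal_ge_le_of_integral_mul_exp_le {Ω : Type*} [MeasurableSpace Ω] {P : Measure Ω}
    [IsProbabilityMeasure P] {Y : Ω → ℝ} {v ε : ℝ} (hv : 0 < v) (hε : 0 ≤ ε)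
    (hint : ∀ θ, Integrable (fun ω => Real.exp (θ * Y ω)) P)
    (h : ∀ θ, 0 ≤ θ → ∫ ω, Y ω * Real.exp (θ * Y ω) ∂P ≤ v * θ * mgf Y P θ) :
    P.real {ω | ε ≤ Y ω} ≤ Real.exp (-(ε ^ 2 / (2 * v))) := by
  have hset : integrableExpSet Y P = Set.univ := Set.eq_univ_of_forall hint
  have hder : ∀ θ, HasDerivAt (mgf Y P) (∫ ω, Y ω * Real.exp (θ * Y ω) ∂P) θ := fun θ =>
    hasDerivAt_mgf (by simp [hset])
  have hder' : ∀ θ, HasDerivAt (fun θ => mgf Y P θ * Real.exp (-(v * θ ^ 2 / 2)))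
      ((∫ ω, Y ω * Real.exp (θ * Y ω) ∂P - v * θ * mgf Y P θ)
        * Real.exp (-(v * θ ^ 2 / 2))) θ := by
    intro θ
    have h1 : HasDerivAt (fun θ : ℝ => -(v * θ ^ 2 / 2)) (-(v * θ)) θ := by
      refine ((((hasDerivAt_id θ).pow 2).const_mul v).div_const 2).neg.congr_deriv ?_
      simp
      ring
    refine ((hder θ).mul h1.exp).congr_deriv ?_
    ring
  -- Grönwall: the hypothesis says exactly that this product has nonpositive derivative for `θ ≥ 0`;
  -- at `0` it equals `1`.
  have hanti : AntitoneOn (fun θ => mgf Y P θ * Real.exp (-(v * θ ^ 2 / 2))) (Set.Ici 0) := by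
    refine antitoneOn_of_deriv_nonpos (convex_Ici 0)
      (fun θ _ => (hder' θ).continuousAt.continuousWithinAt)
      (fun θ _ => (hder' θ).differentiableAt.differentiableWithinAt) fun θ hθ => ?_
    rw [interior_Ici, Set.mem_Ioi] at hθ
    rw [(hder' θ).deriv]
    exact mul_nonpos_of_nonpos_of_nonneg (sub_nonpos.2 (h θ hθ.le)) (Real.exp_pos _).le
  -- The choice `θ = ε / v` minimises the Chernoff exponent `v θ² / 2 - θ ε`.
  have hθ : 0 ≤ ε / v := by positivity
  have hmgf : mgf Y P (ε / v) ≤ Real.exp (v * (ε / v) ^ 2 / 2) := by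
    have := hanti Set.self_mem_Ici hθ hθ
    simp only [mgf_zero] at this
    rw [Real.exp_neg, ← div_eq_mul_inv, div_le_iff₀ (Real.exp_pos _)] at this
    simpa using this
  calc P.real {ω | ε ≤ Y ω} ≤ Real.exp (-(ε / v) * ε) * mgf Y P (ε / v) :=
        measure_ge_le_exp_mul_mgf ε hθ (hint _)
    _ ≤ Real.exp (-(ε / v) * ε) * Real.exp (v * (ε / v) ^ 2 / 2) := by gcongr
    _ = _ := by
        rw [← Real.exp_add]
        congr 1
        field_simp
        ring

lemma IsGibbs.measureReal_ge_le [IsProbabilityMeasure μ] (hμ : IsGibbs μ γ)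
    (hc : transposedDobrushinConst γ ≤ c) (hc1 : c < 1) (hg : OscBounded g d) (hd : 0 < d)
    {ε : ℝ} (hε : 0 ≤ ε) :
    μ.real {ξ | ε ≤ g ξ - ∫ η, g η ∂μ}
      ≤ Real.exp (-((1 - c) * ε ^ 2 / (4 * Fintype.card V * d ^ 2))) := by
  have hn : (0 : ℝ) < Fintype.card V := by exact_mod_cast Fintype.card_pos
  have hc1' : 0 < 1 - c := by linarith
  have hY := hg.sub_const (∫ η, g η ∂μ)
  have h0 : ∫ ξ, (g ξ - ∫ η, g η ∂μ) ∂μ = 0 := by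
    rw [integral_sub hg.integrable (integrable_const _)]; simp
  refine (measureReal_ge_le_of_integral_mul_exp_le
    (v := 2 * d ^ 2 * (Fintype.card V / (1 - c))) (by positivity) hε
    (integrable_exp_of_osc hY.measurable hY.abs_sub_le_card_mul μ) fun θ hθ => ?_).trans_eq ?_
  · have := hμ.integral_sub_integral_mul_exp_le hc hc1 hY hd.le θ
    rw [h0, abs_of_nonneg hθ] at this
    simp only [sub_zero] at this
    refine this.trans_eq ?_
    rw [mgf]
    ring
  · congr 1
    field_simp
    ring

/-- Gaussian concentration for functions of a Gibbs field under the transposed Dobrushin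
condition. -/
theorem IsGibbs.measureReal_abs_ge_le [IsProbabilityMeasure μ] (hμ : IsGibbs μ γ)
    (hc : transposedDobrushinConst γ ≤ c) (hc1 : c < 1) (hg : OscBounded g d) (hd : 0 < d)
    {ε : ℝ} (hε : 0 ≤ ε) :
    μ.real {ξ | ε ≤ |g ξ - ∫ η, g η ∂μ|}
      ≤ 2 * Real.exp (-((1 - c) * ε ^ 2 / (4 * Fintype.card V * d ^ 2))) := by
  have h1 := hμ.measureReal_ge_le hc hc1 hg hd hε
  have h2 := hμ.measureReal_ge_le hc hc1 hg.neg hd hε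
  have hsub : {ξ | ε ≤ |g ξ - ∫ η, g η ∂μ|}
      ⊆ {ξ | ε ≤ g ξ - ∫ η, g η ∂μ} ∪ {ξ | ε ≤ -g ξ - ∫ η, -g η ∂μ} := by
    intro ξ hξ
    rw [integral_neg]
    rcases le_abs.1 (show ε ≤ |g ξ - ∫ η, g η ∂μ| from hξ) with h | h
    · exact Or.inl h
    · exact Or.inr (show ε ≤ -g ξ - -∫ η, g η ∂μ by linarith)
  linarith [(measureReal_mono (μ := μ) hsub).trans (measureReal_union_le _ _)]

end Concentration

/-! ### Empirical averages of window functions -/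

section Window

variable {p N k : ℕ} {E : Set ℝ}

lemma card_window (i : Fin p → ℤ) : (window k i).card = (2 * k + 1) ^ p := by
  have h : ∀ a, (i a + k + 1 - (i a - k)).toNat = 2 * k + 1 := fun a => by omega
  simp [window, Pi.card_Icc, Int.card_Icc, h]

/-- The windows containing `j` are those centred in the window of `j`, so there are at most `(2 * k
+ 1) ^ p` of them. -/
lemma mem_window_comm {i j : Fin p → ℤ} : j ∈ window k i ↔ i ∈ window k j := by
  simp only [window, Finset.mem_Icc, Pi.le_def]
  constructor <;> rintro ⟨h1, h2⟩ <;>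
    exact ⟨fun a => by linarith [h2 a], fun a => by linarith [h1 a]⟩

lemma lattice_nonempty (hN : 1 ≤ N) : (lattice p N).Nonempty :=
  ⟨fun _ => 1, Finset.mem_Icc.2 ⟨le_rfl, fun _ => Nat.one_le_cast.2 hN⟩⟩

/-- The square root of the number of sites would suffice; the full count avoids the root. -/
lemma norm_windowVec_le {M : ℝ} (hM : 0 ≤ M) (hE : ∀ x ∈ E, |x| ≤ M) (i : Fin p → ℤ)
    (x : lattice p N → E) : ‖windowVec k i x‖ ≤ (2 * k + 1) ^ p * M := by
  have hD : (1 : ℝ) ≤ (2 * k + 1) ^ p := one_le_pow₀ (by linarith [k.cast_nonneg (α := ℝ)])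
  have hcard : ((latticeWindow p N k i).card : ℝ) ≤ (2 * k + 1) ^ p := by
    have := Finset.card_le_card (Finset.inter_subset_left (s₁ := window k i) (s₂ := lattice p N))
    rw [card_window] at this
    exact_mod_cast this
  rw [EuclideanSpace.norm_eq]
  refine Real.sqrt_le_iff.2 ⟨by positivity, ?_⟩
  calc ∑ j, ‖windowVec k i x j‖ ^ 2 ≤ ∑ _j : latticeWindow p N k i, M ^ 2 := by
        gcongr with j
        exact hE _ (Subtype.property _)
    _ = (latticeWindow p N k i).card * M ^ 2 := by simp
    _ ≤ (2 * k + 1) ^ p * M ^ 2 := by gcongr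
    _ ≤ ((2 * k + 1) ^ p * (2 * k + 1) ^ p) * M ^ 2 := by
        gcongr
        exact le_mul_of_one_le_left (by positivity) hD
    _ = _ := by ring

lemma windowVec_congr (i : Fin p → ℤ) {j : lattice p N} (hj : j.1 ∉ window k i)
    {x y : lattice p N → E} (h : ∀ l, l ≠ j → x l = y l) : windowVec k i x = windowVec k i y := by
  unfold windowVec
  congr 1
  funext l
  rw [h]
  rintro rfl
  exact hj (Finset.mem_inter.1 l.2).1

lemma measurable_windowVec (i : Fin p → ℤ) :
    Measurable (windowVec k i : (lattice p N → E) → _) :=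
  (WithLp.measurable_toLp 2 _).comp <| measurable_pi_lambda _ fun _ =>
    measurable_subtype_coe.comp (measurable_pi_apply _)

lemma IsPseudoLipschitz.continuous {V : Type*} [Fintype V] {L : ℝ}
    {f : EuclideanSpace ℝ V → ℝ} (hf : IsPseudoLipschitz L f) : Continuous f := by
  refine continuous_iff_continuousAt.2 fun x => tendsto_iff_dist_tendsto_zero.2 ?_
  have hlim : Filter.Tendsto (fun y => L * (1 + ‖y‖ + ‖x‖) * ‖y - x‖) (nhds x) (nhds 0) := by
    have : Continuous fun y => L * (1 + ‖y‖ + ‖x‖) * ‖y - x‖ := by fun_prop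
    simpa using this.tendsto x
  exact squeeze_zero (fun _ => dist_nonneg) (fun y => hf.2 y x) hlim

/-- The average over the lattice of pseudo-Lipschitz functions of the windows changes by
`O(1 / |Γ|)` when a single site is changed. -/
lemma oscBounded_average {M L : ℝ} (hM : 0 ≤ M) (hL : 0 ≤ L) (hE : ∀ x ∈ E, |x| ≤ M)
    {f : (i : lattice p N) → EuclideanSpace ℝ (latticeWindow p N k i.1) → ℝ}
    {Lf : lattice p N → ℝ} (hf : ∀ i, IsPseudoLipschitz (Lf i) (f i)) (hLf : ∀ i, Lf i ≤ L) :
    OscBounded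
      (fun x : lattice p N → E =>
        (1 / ((lattice p N).card : ℝ)) * ∑ i : lattice p N, f i (windowVec k i.1 x))
      ((2 * k + 1) ^ p * (L * (1 + 2 * ((2 * k + 1) ^ p * M)) * (2 * ((2 * k + 1) ^ p * M)))
        / (lattice p N).card) := by
  classical
  set R : ℝ := (2 * k + 1) ^ p * M with hR
  have hR0 : 0 ≤ R := by positivity
  refine ⟨(Finset.measurable_sum _ fun i _ =>
    (hf i).continuous.measurable.comp (measurable_windowVec i.1)).const_mul _,
    fun j x y h => ?_⟩
  -- Only windows containing `j` feel the change; there both window vectors have norm at most `R`.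
  have hterm : ∀ i : lattice p N, |f i (windowVec k i.1 x) - f i (windowVec k i.1 y)|
      ≤ if i.1 ∈ window k j.1 then L * (1 + 2 * R) * (2 * R) else 0 := by
    intro i
    split_ifs with hij
    · have hx := norm_windowVec_le (k := k) hM hE i.1 x
      have hy := norm_windowVec_le (k := k) hM hE i.1 y
      have hxy := norm_sub_le (windowVec k i.1 x) (windowVec k i.1 y)
      refine ((hf i).2 _ _).trans ?_
      rw [← hR] at hx hy
      have h1 : 1 + ‖windowVec k i.1 x‖ + ‖windowVec k i.1 y‖ ≤ 1 + 2 * R := by linarith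
      have h2 : ‖windowVec k i.1 x - windowVec k i.1 y‖ ≤ 2 * R := by linarith
      gcongr
      exact hLf i
    · rw [windowVec_congr i.1 (fun hj => hij (mem_window_comm.1 hj)) h]
      simp
  have hcard : ((Finset.univ.filter fun i : lattice p N => i.1 ∈ window k j.1).card : ℝ)
      ≤ (2 * k + 1) ^ p := by
    have : (Finset.univ.filter fun i : lattice p N => i.1 ∈ window k j.1).card
        ≤ (window k j.1).card :=
      Finset.card_le_card_of_injOn Subtype.val (fun i hi => by simpa using hi)
        Subtype.val_injective.injOn
    rw [card_window] at this
    exact_mod_cast this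
  rw [← mul_sub, ← Finset.sum_sub_distrib, abs_mul, abs_of_nonneg (by positivity), one_div_mul_eq_div]
  gcongr
  calc _ ≤ ∑ i : lattice p N, |f i (windowVec k i.1 x) - f i (windowVec k i.1 y)| :=
        Finset.abs_sum_le_sum_abs _ _
    _ ≤ ∑ i : lattice p N, if i.1 ∈ window k j.1 then L * (1 + 2 * R) * (2 * R) else 0 :=
        Finset.sum_le_sum fun i _ => hterm i
    _ = (Finset.univ.filter fun i : lattice p N => i.1 ∈ window k j.1).card
          * (L * (1 + 2 * R) * (2 * R)) := by
        rw [← Finset.sum_filter, Finset.sum_const, nsmul_eq_mul]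
    _ ≤ _ := by gcongr

lemma integrable_windowVec {M : ℝ} (hE : ∀ x ∈ E, |x| ≤ M) {L : ℝ} {i : Fin p → ℤ}
    {f : EuclideanSpace ℝ (latticeWindow p N k i) → ℝ} (hf : IsPseudoLipschitz L f)
    (μ : Measure (lattice p N → E)) [IsFiniteMeasure μ] :
    Integrable (fun x => f (windowVec k i x)) μ := by
  set R : ℝ := (2 * k + 1) ^ p * |M|
  have hb := norm_windowVec_le (k := k) (N := N) (abs_nonneg M)
    (fun x hx => (hE x hx).trans (le_abs_self M)) i
  refine integrable_of_osc (d := L * (1 + R + R) * (R + R))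
    (hf.continuous.measurable.comp (measurable_windowVec i)) (fun x y => ?_) μ
  have := hf.1.le
  have hR : 0 ≤ R := by positivity
  refine (hf.2 _ _).trans ?_
  have hxy := (norm_sub_le (windowVec k i x) (windowVec k i y)).trans (add_le_add (hb x) (hb y))
  gcongr
  · exact hb x
  · exact hb y

end Window

end LatticeField

/-! ### Choice of constants and conclusion. -/

theorem lemmaC2 (p k : ℕ) (hp : 1 ≤ p) (M L c c' : ℝ) (hc : c < 1) (hc' : c' < 1) :
    ∃ K κ : ℝ, 0 < K ∧ 0 < κ ∧
      ∀ (N q : ℕ), 2 * k + 1 ≤ N →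
      ∀ (E : Set ℝ), (∀ x ∈ E, |x| ≤ M) →
      ∀ {Ω : Type*} [MeasurableSpace Ω] (P : Measure Ω) [IsProbabilityMeasure P]
        (X : Ω → lattice p N → E), Measurable X →
        IsMarkovField q (P.map X) →
        IsStationary (P.map X) →
      ∀ (γ : SingleSiteKernels (lattice p N) E), IsGibbs (P.map X) γ →
        dobrushinConst γ ≤ c →
        transposedDobrushinConst γ ≤ c' →
      ∀ (f : (i : lattice p N) → EuclideanSpace ℝ (latticeWindow p N k i.1) → ℝ)
        (Lf : lattice p N → ℝ),
        (∀ i, IsPseudoLipschitz (Lf i) (f i)) → (∀ i, Lf i ≤ L) →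
      ∀ ε : ℝ, 0 < ε → ε < 1 →
        P.real {ω | ε ≤ |(1 / ((lattice p N).card : ℝ)) *
            ∑ i : lattice p N, (f i (windowVec k i.1 (X ω))
              - ∫ ω', f i (windowVec k i.1 (X ω')) ∂P)|}
          ≤ K * Real.exp (-κ * ((lattice p N).card : ℝ) * ε ^ 2) := by
  -- `M` and `L` have no assumed sign, so they are enlarged to positive numbers, which makes `b`
  -- positive.
  set M' : ℝ := |M| + 1
  set L' : ℝ := |L| + 1
  set b : ℝ := (2 * k + 1) ^ p * (L' * (1 + 2 * ((2 * k + 1) ^ p * M')) *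
    (2 * ((2 * k + 1) ^ p * M')))
  have hM' : 0 < M' := by positivity
  have hL' : 0 < L' := by positivity
  have hb : 0 < b := by positivity
  have hc1 : 0 < 1 - c' := by linarith
  -- The factor `2` counts the two tails; `κ` results from putting `d = b / n` into `(1 - c') * ε ^
  -- 2 / (4 * n * d ^ 2)`.
  refine ⟨2, (1 - c') / (4 * b ^ 2), two_pos, by positivity, ?_⟩
  intro N q hN E hE Ω _ P _ X hX _ _ γ hγ _ hγc f Lf hf hLf ε hε _
  have hne : (lattice p N).Nonempty := lattice_nonempty (by omega)
  have : Nonempty (lattice p N) := hne.to_subtype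
  have hn : (0 : ℝ) < (lattice p N).card := by exact_mod_cast hne.card_pos
  have hμ : IsProbabilityMeasure (P.map X) := Measure.isProbabilityMeasure_map hX.aemeasurable
  set g : (lattice p N → E) → ℝ := fun x =>
    (1 / ((lattice p N).card : ℝ)) * ∑ i : lattice p N, f i (windowVec k i.1 x) with hg
  have hosc : OscBounded g (b / (lattice p N).card) := oscBounded_average hM'.le hL'.le
    (fun x hx => (hE x hx).trans ((le_abs_self M).trans (le_add_of_nonneg_right zero_le_one))) hf
    (fun i => (hLf i).trans ((le_abs_self L).trans (le_add_of_nonneg_right zero_le_one)))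
  have hmean : ∫ x, g x ∂P.map X = (1 / ((lattice p N).card : ℝ)) *
      ∑ i : lattice p N, ∫ ω, f i (windowVec k i.1 (X ω)) ∂P := by
    rw [hg, integral_const_mul,
      integral_finsetSum _ fun i _ => integrable_windowVec hE (hf i) (P.map X)]
    congr 1
    refine Finset.sum_congr rfl fun i _ => integral_map hX.aemeasurable ?_
    exact ((hf i).continuous.measurable.comp (measurable_windowVec i.1)).aestronglyMeasurable
  have hset : {ω | ε ≤ |(1 / ((lattice p N).card : ℝ)) *
      ∑ i : lattice p N, (f i (windowVec k i.1 (X ω))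
        - ∫ ω', f i (windowVec k i.1 (X ω')) ∂P)|}
      = X ⁻¹' {x | ε ≤ |g x - ∫ y, g y ∂P.map X|} := by
    ext ω
    simp only [Set.mem_ofPred_eq, Set.mem_preimage]
    rw [hmean, hg, Finset.sum_sub_distrib, mul_sub]
  rw [hset, ← map_measureReal_apply hX
    (measurableSet_le measurable_const (by have := hosc.measurable; fun_prop))]
  refine (hγ.measureReal_abs_ge_le hγc hc' hosc (by positivity) hε.le).trans_eq ?_
  rw [Fintype.card_coe]
  congr 2
  field_simp
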